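/- Fix an integer $d \ge 3$, nonzero integers $a_1,\dots,a_d$ with $a_1+\cdots+a_d=0$, and a real number $0<\varepsilon<1$. Then there is $N_0$, depending only on $d$, $a_1,\dots,a_d$ and $\varepsilon$, such that the following holds for every prime $N\ge N_0$. Let $f:\mathbb{Z}/N\mathbb{Z}\to[0,1]$ satisfy $\sum_n f(n)=\theta N>0$. Put $\hat f(a)=\sum_{n\in\mathbb{Z}/N\mathbb{Z}} f(n)e^{2\pi i an/N}$, let $\lambda_1,\dots,\lambda_N$ be the $N$ values $\hat f(a)$, $a\in\mathbb{Z}/N\mathbb{Z}$, listed with multiplicity so that $|\lambda_1|\ge|\lambda_2|\ge\cdots\ge|\lambda_N|$, and let $\sigma^2=\sum_{j=1}^N|\lambda_j|^2$. Suppose that for some integer $k$ with $$1000^{d/\varepsilon}\,\theta^{-1/(\varepsilon d)}\,\log N\ \le\ k\ \le\ N^{1/11}$$ we have $$\sum_{k\le j\le N}|\lambda_j|^2\ <\ k^{-(4+10\varepsilon)(d-2)}\,\sigma^2 .$$ Then $$\sum_{\substack{x_1,\dots,x_d\in\mathbb{Z}/N\mathbb{Z}\\ a_1x_1+\cdots+a_dx_d\equiv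 0\ (\mathrm{mod}\ N)}} f(x_1)\cdots f(x_d)\ >\ 10^{-1}\,4^{-d}\,k^{-2(d-2)-2\varepsilon(d-3/2)}\,\theta\,(\theta N)^{d-1}.$$ -/

import Mathlib

namespace SmoothCount

/-- The Fourier transform `a ↦ ∑ n, f n * exp (2 * π * i * a * n / N)` of `f : ℤ/N → ℝ`. -/
noncomputable def fourier {N : ℕ} [NeZero N] (f : ZMod N → ℝ) (a : ZMod N) : ℂ :=
  ∑ n : ZMod N, (f n : ℂ) * ZMod.stdAddChar (a * n)

/-- `b` lists the elements of `ℤ/N` so that the Fourier coefficients of `f` at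
`b 0, b 1, …, b (N - 1)` have non-increasing absolute values. -/
def IsDecreasingOrder {N : ℕ} [NeZero N] (f : ZMod N → ℝ) (b : Fin N ≃ ZMod N) : Prop :=
  ∀ i j : Fin N, i ≤ j → ‖fourier f (b j)‖ ≤ ‖fourier f (b i)‖

/-- `∑_{k ≤ j ≤ N} |λ_j|²`, where `λ_j = fourier f (b (j - 1))` for `j = 1, …, N`
(the index `i : Fin N` corresponds to `j = i + 1`). -/
noncomputable def tailEnergy {N : ℕ} [NeZero N] (f : ZMod N → ℝ) (b : Fin N ≃ ZMod N)
    (k : ℕ) : ℝ :=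
  ∑ i ∈ Finset.univ.filter (fun i : Fin N => k ≤ i.val + 1), ‖fourier f (b i)‖ ^ 2

/-- `σ² = ∑_j |λ_j|²`, the sum over all Fourier coefficients. -/
noncomputable def energy {N : ℕ} [NeZero N] (f : ZMod N → ℝ) : ℝ :=
  ∑ a : ZMod N, ‖fourier f a‖ ^ 2

/-- The sum of `f (x 1) ⋯ f (x d)` over all `x` in `(ℤ/N)^d` with
`a 1 * x 1 + ⋯ + a d * x d = 0` in `ℤ/N`. -/
noncomputable def weightedCount {N : ℕ} [NeZero N] {d : ℕ} (a : Fin d → ℤ)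
    (f : ZMod N → ℝ) : ℝ :=
  ∑ x : Fin d → ZMod N with ∑ i, (a i : ZMod N) * x i = 0, ∏ i, f (x i)

end SmoothCount

namespace SmoothCount

open Finset

/-! Write Q = θN, and let R(s) be the f-weighted number of representations of s by a linear form. As
the a_i sum to 0, moving one of them across turns the count into ∑ f(u) R(σu), where σ is the sum of
the other coefficients. It suffices that R(σu) is large on a set of u carrying a fixed share of the
mass of f.

This goes by induction on the length of the form (`le_sum_popular`). Suppose that adjoining a to a
form with coefficient sum ρ ≠ 0 and count R fails, and put σ = a + ρ. Then on a set P of substantial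
mass R(ρu) is large while ∑ f(v) R(σu - av) is small, so the kernel R(σu - av) has a large diagonal
but a small average. Since f has little Fourier energy outside fewer than k frequencies, R is
L²-close to a combination of fewer than k characters (`exists_approx_repCount`), and the kernel is
close to one of rank below k. Sampling k points of P gives a nearly singular k × k matrix, which
cannot be strongly diagonally dominant; averaging over samples (`mul_sq_le_of_low_rank`) yields
`density_increment_le`.

Each of the d - 2 adjunctions costs a factor of order k² in the count and 2 in the mass; powers of
k^ε absorb θ and the constants. -/

/-- The sum of `∏ f (x i)` over the solutions `x` of `∑ i, l i * x i = s`, where `l` lists the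
coefficients. -/
noncomputable def repCount {N : ℕ} [NeZero N] (f : ZMod N → ℝ) : List (ZMod N) → ZMod N → ℝ
  | [], s => if s = 0 then 1 else 0
  | a :: l, s => ∑ x, f x * repCount f l (s - a * x)

/-! ### Weighted representation counts of linear forms. -/

section RepCount

variable {N : ℕ} [NeZero N] {f : ZMod N → ℝ}

/-- Needed because the induction must choose which coefficient to split off. -/
theorem repCount_perm {l l' : List (ZMod N)} (h : l.Perm l') :
    repCount f l = repCount f l' := by
  induction h with
  | nil => rfl
  | cons a _ ih => funext s; simp only [repCount, ih]
  | swap a b l =>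
    funext s
    simp only [repCount, mul_sum]
    rw [sum_comm]
    refine sum_congr rfl fun x _ => sum_congr rfl fun y _ => ?_
    rw [show s - b * y - a * x = s - a * x - b * y by ring]
    ring
  | trans _ _ ih₁ ih₂ => exact ih₁.trans ih₂

theorem repCount_nonneg (hf : ∀ n, 0 ≤ f n) (l : List (ZMod N)) (s : ZMod N) :
    0 ≤ repCount f l s := by
  induction l generalizing s with
  | nil => simp only [repCount]; split_ifs <;> norm_num
  | cons a l ih => exact sum_nonneg fun x _ => mul_nonneg (hf x) (ih _)

theorem sum_repCount (l : List (ZMod N)) :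
    ∑ s, repCount f l s = (∑ n, f n) ^ l.length := by
  induction l with
  | nil => simp [repCount]
  | cons a l ih =>
    simp only [repCount]
    rw [sum_comm]
    have : ∀ x, ∑ s, f x * repCount f l (s - a * x) = f x * (∑ n, f n) ^ l.length := by
      intro x
      rw [← mul_sum, ← ih]
      congr 1
      exact Fintype.sum_equiv (Equiv.subRight (a * x)) _ _ fun _ => rfl
    simp only [this, ← sum_mul, List.length_cons, pow_succ']

theorem repCount_ofFn {n : ℕ} (a : Fin n → ZMod N) (s : ZMod N) :
    repCount f (List.ofFn a) s = ∑ x : Fin n → ZMod N with ∑ i, a i * x i = s, ∏ i, f (x i) := by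
  induction n generalizing s with
  | zero => by_cases hs : s = 0 <;> simp [repCount, hs, eq_comm]
  | succ n ih =>
    rw [List.ofFn_succ, repCount, sum_filter,
      ← (Fin.consEquiv fun _ : Fin (n + 1) => ZMod N).sum_comp, Fintype.sum_prod_type]
    refine sum_congr rfl fun y _ => ?_
    rw [ih, sum_filter, mul_sum]
    refine sum_congr rfl fun x _ => ?_
    simp only [Fin.consEquiv_apply, Fin.sum_univ_succ, Fin.prod_univ_succ, Fin.cons_zero,
      Fin.cons_succ, mul_ite, mul_zero]
    refine if_congr ?_ rfl rfl
    rw [eq_sub_iff_add_eq, add_comm]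

end RepCount

/-! ### Orthogonality, Parseval and inversion. -/

section Fourier

variable {N : ℕ} [NeZero N]

theorem sum_stdAddChar_mul (t : ZMod N) :
    ∑ x : ZMod N, ZMod.stdAddChar (t * x) = if t = 0 then (N : ℂ) else 0 := by
  have := AddChar.sum_mulShift t (ZMod.isPrimitive_stdAddChar N)
  rw [ZMod.card, Nat.cast_ite, Nat.cast_zero] at this
  rw [← this]
  exact sum_congr rfl fun x _ => by rw [mul_comm]

theorem parseval (c : ZMod N → ℂ) :
    ∑ x, ‖∑ t, c t * ZMod.stdAddChar (x * t)‖ ^ 2 = N * ∑ t, ‖c t‖ ^ 2 := by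
  have h : (∑ x, (‖∑ t, c t * ZMod.stdAddChar (x * t)‖ ^ 2 : ℂ)) = N * ∑ t, (‖c t‖ : ℂ) ^ 2 := by
    have h₁ : ∀ x, (‖∑ t, c t * ZMod.stdAddChar (x * t)‖ ^ 2 : ℂ)
        = ∑ t, ∑ u, c t * (starRingEnd ℂ) (c u) * ZMod.stdAddChar ((t - u) * x) := by
      intro x
      rw [← Complex.mul_conj', map_sum, sum_mul_sum]
      refine sum_congr rfl fun t _ => sum_congr rfl fun u _ => ?_
      rw [map_mul (starRingEnd ℂ), ← AddChar.map_neg_eq_conj, sub_mul, sub_eq_add_neg, AddChar.map_add_eq_mul,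
        mul_comm t x, mul_comm u x]
      ring
    simp only [h₁]
    rw [sum_comm, mul_sum]
    refine sum_congr rfl fun t _ => ?_
    rw [sum_comm]
    simp only [← mul_sum, sum_stdAddChar_mul, sub_eq_zero, mul_ite, mul_zero]
    rw [sum_ite_eq univ t, if_pos (mem_univ t), Complex.mul_conj', mul_comm]
  exact_mod_cast h

theorem energy_eq (f : ZMod N → ℝ) : energy f = N * ∑ n, f n ^ 2 := by
  have := parseval fun n => (f n : ℂ)
  simpa [energy, fourier] using this

theorem fourier_inversion (f : ZMod N → ℝ) (x : ZMod N) :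
    (f x : ℂ) = (N : ℂ)⁻¹ * ∑ t, fourier f t * ZMod.stdAddChar (-(t * x)) := by
  have hN : (N : ℂ) ≠ 0 := Nat.cast_ne_zero.2 (NeZero.ne N)
  rw [eq_inv_mul_iff_mul_eq₀ hN]
  simp only [fourier, sum_mul]
  rw [sum_comm]
  have : ∀ n, ∑ t, (f n : ℂ) * ZMod.stdAddChar (t * n) * ZMod.stdAddChar (-(t * x))
      = f n * if n - x = 0 then (N : ℂ) else 0 := by
    intro n
    rw [← sum_stdAddChar_mul, mul_sum]
    refine sum_congr rfl fun t _ => ?_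
    rw [mul_assoc, ← AddChar.map_add_eq_mul]
    ring_nf
  simp only [this, sub_eq_zero, mul_ite, mul_zero, sum_ite_eq', mem_univ, if_true]
  exact mul_comm _ _

end Fourier

/-! ### Averages over independent samples. -/

section Expectation

variable {α κ : Type*} [Fintype α] [Fintype κ] [DecidableEq κ] {w : α → ℝ} {W : ℝ}

/-- Expectation under independent sampling from the unnormalised weight w; the powers of W replace
division by the total mass. -/
theorem sum_pi_prod_mul_apply (hW : ∑ u, w u = W) (i : κ) (h : α → ℝ) :
    W * ∑ x : κ → α, (∏ l, w (x l)) * h (x i) = W ^ Fintype.card κ * ∑ u, w u * h u := by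
  classical
  have key : ∑ x : κ → α, (∏ l, w (x l)) * h (x i)
      = ∏ l, ∑ u, w u * (if l = i then h u else 1) := by
    rw [Fintype.prod_sum]
    refine sum_congr rfl fun x _ => ?_
    rw [prod_mul_distrib]
    simp
  have h₁ : ∀ l ∈ univ.erase i, ∑ u, w u * (if l = i then h u else 1) = W := by
    intro l hl
    simp [(mem_erase.1 hl).1, hW]
  rw [key, ← mul_prod_erase univ _ (mem_univ i), prod_congr rfl h₁, prod_const,
    card_erase_of_mem (mem_univ i), card_univ]
  have : 0 < Fintype.card κ := Fintype.card_pos_iff.2 ⟨i⟩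
  simp only [if_true]
  rw [mul_comm (∑ u, _), ← mul_assoc, ← pow_succ', Nat.sub_add_cancel this]

theorem sum_pi_prod_mul_apply_apply (hW : ∑ u, w u = W) {i j : κ} (hij : i ≠ j)
    (h : α → α → ℝ) :
    W ^ 2 * ∑ x : κ → α, (∏ l, w (x l)) * h (x i) (x j)
      = W ^ Fintype.card κ * ∑ u, ∑ v, w u * w v * h u v := by
  classical
  -- Fixing the value of x i makes the summand a product over the coordinates.
  have key : ∀ a : α, ∑ x : κ → α, (∏ l, w (x l)) * (if x i = a then h a (x j) else 0)
      = ∏ l, ∑ u, w u * ((if l = i then (if u = a then 1 else 0) else 1)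
          * (if l = j then h a u else 1)) := by
    intro a
    rw [Fintype.prod_sum]
    refine sum_congr rfl fun x _ => ?_
    rw [prod_mul_distrib, prod_mul_distrib]
    simp
  have hj : j ∈ univ.erase i := mem_erase.2 ⟨hij.symm, mem_univ j⟩
  have h₁ : ∀ a, ∀ l ∈ (univ.erase i).erase j,
      ∑ u, w u * ((if l = i then (if u = a then 1 else 0) else 1)
          * (if l = j then h a u else 1)) = W := by
    intro a l hl
    simp [(mem_erase.1 hl).1, (mem_erase.1 (mem_erase.1 hl).2).1, hW]
  have h₂ : ∑ x : κ → α, (∏ l, w (x l)) * h (x i) (x j)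
      = ∑ a, ∑ x : κ → α, (∏ l, w (x l)) * (if x i = a then h a (x j) else 0) := by
    rw [sum_comm]
    refine sum_congr rfl fun x _ => ?_
    simp
  rw [h₂, mul_sum, mul_sum]
  refine sum_congr rfl fun a _ => ?_
  have hc : 2 ≤ Fintype.card κ := Fintype.one_lt_card_iff.2 ⟨i, j, hij⟩
  rw [key, ← mul_prod_erase univ _ (mem_univ i), ← mul_prod_erase _ _ hj, prod_congr rfl (h₁ a),
    prod_const, card_erase_of_mem hj, card_erase_of_mem (mem_univ i), card_univ]
  obtain ⟨m, hm⟩ := Nat.exists_eq_add_of_le' hc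
  simp only [if_true, hij, hij.symm, if_false, hm, mul_one, one_mul, mul_ite, mul_zero,
    sum_ite_eq', mem_univ]
  rw [show m + 2 - 1 - 1 = m by omega, show ∑ v, w a * w v * h a v = w a * ∑ v, w v * h a v by
    rw [mul_sum]; exact sum_congr rfl fun _ _ => by ring]
  ring

end Expectation

/-! ### Kernels close to low rank. -/

section LowRank

variable {α τ : Type*}

/-- A matrix that is close to one of rank less than its size is not diagonally dominant. -/
theorem exists_diag_le_of_low_rank {k : ℕ} (B : Finset τ) (hB : B.card < k)
    (M : Fin k → Fin k → ℂ) (g h : τ → Fin k → ℂ) :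
    ∃ i, ‖M i i‖ ≤ ∑ j ∈ univ.erase i, ‖M i j‖
      + ∑ j, ‖M i j - ∑ t ∈ B, g t i * h t j‖ := by
  classical
  -- Fewer than k linear conditions in k unknowns have a nonzero solution v, which the low-rank part
  -- annihilates. The row used is the one where |v| is largest.
  let L : (Fin k → ℂ) →ₗ[ℂ] (B → ℂ) := Matrix.mulVecLin (Matrix.of fun t j => h t.1 j)
  have hL : LinearMap.ker L ≠ ⊥ := LinearMap.ker_ne_bot_of_finrank_lt (by simpa using hB)
  obtain ⟨v, hv, hv0⟩ := (Submodule.ne_bot_iff _).1 hL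
  have hv' : ∀ t ∈ B, ∑ j, h t j * v j = 0 := fun t ht =>
    congrFun (LinearMap.mem_ker.1 hv) ⟨t, ht⟩
  obtain ⟨j₀, hj₀⟩ := Function.ne_iff.1 hv0
  obtain ⟨i, -, hi⟩ := exists_max_image univ (fun j => ‖v j‖) ⟨j₀, mem_univ _⟩
  have hpos : 0 < ‖v i‖ := (norm_pos_iff.2 hj₀).trans_le (hi j₀ (mem_univ _))
  refine ⟨i, ?_⟩
  have hK : ∑ j, (∑ t ∈ B, g t i * h t j) * v j = 0 := by
    simp only [sum_mul]
    rw [sum_comm]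
    refine sum_eq_zero fun t ht => ?_
    simp only [mul_assoc]
    rw [← mul_sum, hv' t ht, mul_zero]
  have e : M i i * v i = -∑ j ∈ univ.erase i, M i j * v j
      + ∑ j, (M i j - ∑ t ∈ B, g t i * h t j) * v j := by
    simp only [sub_mul, sum_sub_distrib]
    rw [hK, ← add_sum_erase univ (fun j => M i j * v j) (mem_univ i)]
    ring
  have bd : ∀ (s : Finset (Fin k)) (c : Fin k → ℂ),
      ‖∑ j ∈ s, c j * v j‖ ≤ (∑ j ∈ s, ‖c j‖) * ‖v i‖ := by
    intro s c
    rw [sum_mul]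
    refine (norm_sum_le _ _).trans (sum_le_sum fun j _ => ?_)
    rw [norm_mul]
    exact mul_le_mul_of_nonneg_left (hi j (mem_univ _)) (norm_nonneg _)
  refine le_of_mul_le_mul_right ?_ hpos
  rw [← norm_mul, e, add_mul]
  refine (norm_add_le _ _).trans (add_le_add ?_ (bd _ _))
  rw [norm_neg]
  exact bd _ _

/-- A nonnegative kernel that is at least `δ` on the diagonal and close to one of rank less
than `k` has a large average. -/
theorem mul_sq_le_of_low_rank [Fintype α] {k : ℕ} (B : Finset τ) (hB : B.card < k)
    {M : α → α → ℝ} (hM : ∀ u v, 0 ≤ M u v) (g h : τ → α → ℂ) {w : α → ℝ} (hw : ∀ u, 0 ≤ w u)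
    {W δ : ℝ} (hW : ∑ u, w u = W) (hW0 : 0 < W) (hδ : ∀ u, 0 < w u → δ ≤ M u u) :
    δ * W ^ 2 ≤ k ^ 2 * (∑ u, ∑ v, w u * w v *
        (M u v + ‖(M u v : ℂ) - ∑ t ∈ B, g t u * h t v‖))
      + k * W * ∑ u, w u * ‖(M u u : ℂ) - ∑ t ∈ B, g t u * h t u‖ := by
  classical
  set T : α → α → ℝ := fun u v => ‖(M u v : ℂ) - ∑ t ∈ B, g t u * h t v‖ with hT
  have hT0 : ∀ u v, 0 ≤ T u v := fun u v => norm_nonneg _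
  -- The good row depends on x, so all rows are summed. Diagonal errors stay separate: they involve
  -- one sample point, the other terms two independent ones.
  have point : ∀ x : Fin k → α, (∏ l, w (x l)) * δ ≤
      (∏ l, w (x l)) * (∑ i, ∑ j ∈ univ.erase i, (M (x i) (x j) + T (x i) (x j))
        + ∑ i, T (x i) (x i)) := by
    intro x
    rcases (prod_nonneg fun l _ => hw (x l) : 0 ≤ ∏ l, w (x l)).eq_or_lt with h0 | hpos
    · simp [← h0]
    refine mul_le_mul_of_nonneg_left ?_ hpos.le
    obtain ⟨i, hi⟩ := exists_diag_le_of_low_rank B hB (fun i j => (M (x i) (x j) : ℂ))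
      (fun t i => g t (x i)) (fun t j => h t (x j))
    have hwi : 0 < w (x i) := (hw _).lt_of_ne' (prod_ne_zero_iff.1 hpos.ne' i (mem_univ i))
    have hn : ∀ u v, ‖(M u v : ℂ)‖ = M u v := fun u v => by
      rw [Complex.norm_real, Real.norm_of_nonneg (hM u v)]
    simp only [hn] at hi
    have h₁ : ∑ j, T (x i) (x j) = T (x i) (x i) + ∑ j ∈ univ.erase i, T (x i) (x j) :=
      (add_sum_erase univ (fun j => T (x i) (x j)) (mem_univ i)).symm
    have h₂ : ∑ j ∈ univ.erase i, (M (x i) (x j) + T (x i) (x j))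
        ≤ ∑ i, ∑ j ∈ univ.erase i, (M (x i) (x j) + T (x i) (x j)) :=
      single_le_sum (f := fun i => ∑ j ∈ univ.erase i, (M (x i) (x j) + T (x i) (x j)))
        (fun i _ => sum_nonneg fun j _ => add_nonneg (hM _ _) (hT0 _ _)) (mem_univ i)
    have h₃ : T (x i) (x i) ≤ ∑ i, T (x i) (x i) :=
      single_le_sum (f := fun i => T (x i) (x i)) (fun i _ => hT0 _ _) (mem_univ i)
    rw [sum_add_distrib] at h₂
    have := hδ _ hwi
    change _ ≤ _ + ∑ j, T (x i) (x j) at hi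
    linarith
  have hsum := sum_le_sum fun x (_ : x ∈ univ) => point x
  have hprod : ∑ x : Fin k → α, ∏ l, w (x l) = W ^ k := by
    rw [← Fintype.prod_sum (fun (_ : Fin k) u => w u)]
    simp [hW]
  rw [← sum_mul, hprod] at hsum
  have hoff : W ^ 2 * ∑ x : Fin k → α, (∏ l, w (x l)) *
      ∑ i, ∑ j ∈ univ.erase i, (M (x i) (x j) + T (x i) (x j))
      ≤ W ^ k * (k ^ 2 * ∑ u, ∑ v, w u * w v * (M u v + T u v)) := by
    have hS : 0 ≤ ∑ u, ∑ v, w u * w v * (M u v + T u v) :=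
      sum_nonneg fun u _ => sum_nonneg fun v _ =>
        mul_nonneg (mul_nonneg (hw _) (hw _)) (add_nonneg (hM _ _) (hT0 _ _))
    have : W ^ 2 * ∑ x : Fin k → α, (∏ l, w (x l)) *
        ∑ i, ∑ j ∈ univ.erase i, (M (x i) (x j) + T (x i) (x j))
        = ∑ i : Fin k, ∑ j ∈ univ.erase i,
          W ^ k * ∑ u, ∑ v, w u * w v * (M u v + T u v) := by
      simp only [mul_sum (s := univ (α := Fin k)), mul_sum (s := univ.erase _)]
      rw [mul_sum]
      simp only [mul_sum (s := univ (α := Fin k)), mul_sum (s := univ.erase _)]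
      rw [sum_comm]
      refine sum_congr rfl fun i _ => ?_
      rw [sum_comm]
      refine sum_congr rfl fun j hj => ?_
      rw [← mul_sum, sum_pi_prod_mul_apply_apply hW (mem_erase.1 hj).1.symm
        (fun u v => M u v + T u v), Fintype.card_fin]
    rw [this]
    simp only [sum_const, card_erase_of_mem (mem_univ _), card_univ, Fintype.card_fin,
      nsmul_eq_mul]
    have hk : ((k - 1 : ℕ) : ℝ) ≤ k := by exact_mod_cast Nat.sub_le k 1
    have h0 : 0 ≤ W ^ k * ∑ u, ∑ v, w u * w v * (M u v + T u v) := by positivity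
    calc _ ≤ (k : ℝ) * (k * (W ^ k * ∑ u, ∑ v, w u * w v * (M u v + T u v))) := by gcongr
      _ = _ := by ring
  have hdiag : W * ∑ x : Fin k → α, (∏ l, w (x l)) * ∑ i, T (x i) (x i)
      = W ^ k * (k * ∑ u, w u * T u u) := by
    simp only [mul_sum (s := univ (α := Fin k))]
    rw [sum_comm, mul_sum, sum_congr rfl fun i _ =>
      sum_pi_prod_mul_apply hW i fun u => T u u]
    simp only [sum_const, card_univ, Fintype.card_fin, nsmul_eq_mul]
    ring
  simp only [mul_add, sum_add_distrib (s := univ (α := Fin k → α))] at hsum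
  refine le_of_mul_le_mul_left ?_ (pow_pos hW0 k)
  calc W ^ k * (δ * W ^ 2) = W ^ 2 * (W ^ k * δ) := by ring
    _ ≤ W ^ 2 * _ := mul_le_mul_of_nonneg_left hsum (by positivity)
    _ = W ^ 2 * (∑ x : Fin k → α, (∏ l, w (x l)) *
          ∑ i, ∑ j ∈ univ.erase i, (M (x i) (x j) + T (x i) (x j)))
        + W * (W * ∑ x : Fin k → α, (∏ l, w (x l)) * ∑ i, T (x i) (x i)) := by ring
    _ ≤ _ := by
      rw [hdiag]
      refine (add_le_add_left hoff _).trans (le_of_eq ?_)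
      ring

end LowRank

/-! ### Truncating the spectrum. -/

section Spectrum

variable {N : ℕ} [NeZero N]

theorem sum_norm_sub_truncation_sq (f : ZMod N → ℝ) (B : Finset (ZMod N)) :
    ∑ x, ‖(f x : ℂ) - (N : ℂ)⁻¹ * ∑ t ∈ B, fourier f t * ZMod.stdAddChar (-(t * x))‖ ^ 2
      = (N : ℝ)⁻¹ * ∑ t ∈ Bᶜ, ‖fourier f t‖ ^ 2 := by
  have hN : (N : ℝ) ≠ 0 := Nat.cast_ne_zero.2 (NeZero.ne N)
  have h := parseval fun t => if t ∈ B then 0 else (N : ℂ)⁻¹ * fourier f t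
  rw [← Equiv.sum_comp (Equiv.neg (ZMod N))] at h
  have h₁ : ∀ x, (f x : ℂ) - (N : ℂ)⁻¹ * ∑ t ∈ B, fourier f t * ZMod.stdAddChar (-(t * x))
      = ∑ t, (if t ∈ B then 0 else (N : ℂ)⁻¹ * fourier f t)
        * ZMod.stdAddChar (Equiv.neg (ZMod N) x * t) := by
    intro x
    rw [fourier_inversion f x, ← sum_add_sum_compl B, mul_add, add_sub_cancel_left, mul_sum,
      ← sum_add_sum_compl B fun t => (if t ∈ B then 0 else (N : ℂ)⁻¹ * fourier f t)
        * ZMod.stdAddChar (Equiv.neg (ZMod N) x * t)]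
    rw [sum_eq_zero (s := B) fun t ht => by rw [if_pos ht, zero_mul], zero_add]
    refine sum_congr rfl fun t ht => ?_
    rw [if_neg (mem_compl.1 ht), Equiv.neg_apply, neg_mul, mul_comm x t, mul_assoc]
  simp only [h₁]
  rw [h, ← sum_add_sum_compl B]
  rw [sum_eq_zero (s := B) fun t ht => by simp [ht], zero_add, mul_sum, mul_sum]
  refine sum_congr rfl fun t ht => ?_
  rw [if_neg (mem_compl.1 ht), norm_mul, norm_inv, Complex.norm_natCast]
  field_simp

theorem energy_le {f : ZMod N → ℝ} (hf : ∀ n, 0 ≤ f n ∧ f n ≤ 1) :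
    energy f ≤ N * ∑ n, f n := by
  rw [energy_eq]
  refine mul_le_mul_of_nonneg_left (sum_le_sum fun n _ => ?_) (Nat.cast_nonneg N)
  nlinarith [hf n]

theorem exists_sum_compl_eq_tailEnergy (f : ZMod N → ℝ) (b : Fin N ≃ ZMod N) {k : ℕ}
    (hk : 0 < k) :
    ∃ B : Finset (ZMod N), B.card < k ∧ ∑ t ∈ Bᶜ, ‖fourier f t‖ ^ 2 = tailEnergy f b k := by
  -- The tail starts at j = k, so at most k - 1 frequencies remain, as the strict rank bound
  -- requires.
  refine ⟨(univ.filter fun i : Fin N => i.val + 1 < k).map b.toEmbedding, ?_, ?_⟩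
  · rw [card_map, ← card_map Fin.valEmbedding]
    refine (card_le_card (t := range (k - 1)) fun i hi => ?_).trans_lt
      (by rw [card_range]; omega)
    obtain ⟨j, hj, rfl⟩ := mem_map.1 hi
    have := (mem_filter.1 hj).2
    simp only [Fin.valEmbedding_apply, mem_range]
    omega
  · have : ((univ.filter fun i : Fin N => i.val + 1 < k).map b.toEmbedding)ᶜ
        = (univ.filter fun i : Fin N => k ≤ i.val + 1).map b.toEmbedding := by
      ext t
      obtain ⟨i, rfl⟩ := b.surjective t
      simp
    rw [this, sum_map]
    rfl

end Spectrum

/-! ### The induction on the number of coefficients. -/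

section Prime

variable {N : ℕ} [Fact N.Prime] {f : ZMod N → ℝ}

/-- A weighted representation count is close in `L²` to a combination of the characters attached
to `B` if `f` has little Fourier energy outside `B`. -/
theorem exists_approx_repCount (hf : ∀ n, 0 ≤ f n) (B : Finset (ZMod N)) {a : ZMod N}
    (ha : a ≠ 0) (l : List (ZMod N)) :
    ∃ c : ZMod N → ℂ,
      ∑ s, ‖(repCount f (a :: l) s : ℂ)
          - ∑ t ∈ B, c t * ZMod.stdAddChar (-(t * a⁻¹ * s))‖ ^ 2
        ≤ ((∑ n, f n) ^ l.length) ^ 2 * ((N : ℝ)⁻¹ * ∑ t ∈ Bᶜ, ‖fourier f t‖ ^ 2) := by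
  set q : ℝ := (∑ n, f n) ^ l.length with hq
  set F : ZMod N → ℂ := fun x =>
    (f x : ℂ) - (N : ℂ)⁻¹ * ∑ t ∈ B, fourier f t * ZMod.stdAddChar (-(t * x)) with hF
  let R := repCount f l
  have hR : ∀ s, 0 ≤ R s := repCount_nonneg hf l
  let e : ZMod N → ZMod N ≃ ZMod N := fun s => (Equiv.mulLeft₀ a ha).trans (Equiv.subLeft s)
  have he : ∀ s x, e s x = s - a * x := fun s x => rfl
  -- The count is R convolved with a dilate of f. Truncating f to B leaves only the frequencies t *
  -- a⁻¹ with t in B, weighted by the product of the two transforms.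
  refine ⟨fun t => (N : ℂ)⁻¹ * fourier f t * ∑ u, (R u : ℂ) * ZMod.stdAddChar (t * a⁻¹ * u), ?_⟩
  have h₁ : ∀ s, (repCount f (a :: l) s : ℂ) - ∑ t ∈ B, ((N : ℂ)⁻¹ * fourier f t
      * ∑ u, (R u : ℂ) * ZMod.stdAddChar (t * a⁻¹ * u)) * ZMod.stdAddChar (-(t * a⁻¹ * s))
      = ∑ x, F x * R (s - a * x) := by
    intro s
    have h₂ : ∀ t, (∑ u, (R u : ℂ) * ZMod.stdAddChar (t * a⁻¹ * u))
        * ZMod.stdAddChar (-(t * a⁻¹ * s))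
        = ∑ x, (R (s - a * x) : ℂ) * ZMod.stdAddChar (-(t * x)) := by
      intro t
      rw [← (e s).sum_comp, sum_mul]
      refine sum_congr rfl fun x _ => ?_
      rw [he, mul_assoc, ← AddChar.map_add_eq_mul]
      congr 2
      field_simp
      ring
    simp only [hF, sub_mul, sum_sub_distrib, repCount, Complex.ofReal_sum, Complex.ofReal_mul]
    congr 1
    have h₃ : ∀ t, (N : ℂ)⁻¹ * fourier f t * (∑ u, (R u : ℂ) * ZMod.stdAddChar (t * a⁻¹ * u))
        * ZMod.stdAddChar (-(t * a⁻¹ * s)) = (N : ℂ)⁻¹ * fourier f t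
          * ∑ x, (R (s - a * x) : ℂ) * ZMod.stdAddChar (-(t * x)) := by
      intro t
      rw [mul_assoc, h₂]
    simp only [h₃]
    simp only [mul_sum, sum_mul]
    rw [sum_comm]
    refine sum_congr rfl fun x _ => sum_congr rfl fun t _ => ?_
    ring
  simp only [h₁]
  have hRs : ∀ s, ∑ x, R (s - a * x) = q := by
    intro s
    rw [hq, ← sum_repCount l]
    exact (e s).sum_comp R
  -- Cauchy–Schwarz with weight R, of total mass q: convolution with R enlarges the L² norm at most
  -- q times.
  have h₃ : ∀ s, ‖∑ x, F x * R (s - a * x)‖ ^ 2 ≤ q * ∑ x, ‖F x‖ ^ 2 * R (s - a * x) := by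
    intro s
    have h₄ : ‖∑ x, F x * R (s - a * x)‖ ≤ ∑ x, ‖F x‖ * R (s - a * x) := by
      refine (norm_sum_le _ _).trans (le_of_eq (sum_congr rfl fun x _ => ?_))
      rw [norm_mul, Complex.norm_real, Real.norm_of_nonneg (hR _)]
    refine (pow_le_pow_left₀ (norm_nonneg _) h₄ 2).trans ?_
    have := sum_sq_le_sum_mul_sum_of_sq_le_mul univ
      (r := fun x => ‖F x‖ * R (s - a * x)) (f := fun x => R (s - a * x))
      (g := fun x => ‖F x‖ ^ 2 * R (s - a * x)) (fun x _ => hR _)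
      (fun x _ => mul_nonneg (sq_nonneg _) (hR _)) (fun x _ => le_of_eq (by ring))
    rwa [hRs] at this
  refine (sum_le_sum fun s _ => h₃ s).trans (le_of_eq ?_)
  rw [← mul_sum, sum_comm]
  have h₅ : ∀ x, ∑ s, ‖F x‖ ^ 2 * R (s - a * x) = q * ‖F x‖ ^ 2 := by
    intro x
    rw [← mul_sum, mul_comm, hq, ← sum_repCount l]
    congr 1
    exact (Equiv.subRight (a * x)).sum_comp R
  rw [sum_congr rfl fun x _ => h₅ x, ← mul_sum, ← sum_norm_sub_truncation_sq]
  ring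

/-- If the solutions of a contracted equation are dense at the points of `P`, then the solutions
of the full equation cannot be sparse at all these points. -/
theorem density_increment_le (hf : ∀ n, 0 ≤ f n ∧ f n ≤ 1) {Q : ℝ} (hQ : ∑ n, f n = Q)
    (hQ0 : 0 < Q) {k : ℕ} {B : Finset (ZMod N)} (hB : B.card < k) {τ : ℝ} (hτ : 0 ≤ τ)
    (hE : ∑ t ∈ Bᶜ, ‖fourier f t‖ ^ 2 ≤ τ ^ 2 * (N * Q)) {a a' : ZMod N} (ha : a ≠ 0)
    (ha' : a' ≠ 0) {l : List (ZMod N)} (hl : (a' :: l).sum ≠ 0) {p δ δ' : ℝ} (hp : 0 < p)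
    (hδ'0 : 0 ≤ δ') (P : Finset (ZMod N)) (hP : p * Q ≤ ∑ u ∈ P, f u)
    (hδ' : ∀ u ∈ P, δ' * Q ^ l.length ≤ repCount f (a' :: l) ((a' :: l).sum * u))
    (hδ : ∀ u ∈ P, repCount f (a :: a' :: l) ((a :: a' :: l).sum * u) ≤ δ * Q ^ (l.length + 1)) :
    δ' * p ≤ k ^ 2 * δ + 2 * k ^ 2 * τ := by
  have hN : (0 : ℝ) < N := Nat.cast_pos.2 (NeZero.pos N)
  have hf0 : ∀ n, 0 ≤ f n := fun n => (hf n).1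
  set n := l.length with hn
  set σ := (a :: a' :: l).sum with hσ
  set ρ := (a' :: l).sum with hρ
  have hσρ : σ = a + ρ := by simp [hσ, hρ]
  set R := repCount f (a' :: l) with hR
  have hR0 : ∀ s, 0 ≤ R s := repCount_nonneg hf0 _
  obtain ⟨c, hc⟩ := exists_approx_repCount hf0 B ha' l
  set T : ZMod N → ℝ := fun s =>
    ‖(R s : ℂ) - ∑ t ∈ B, c t * ZMod.stdAddChar (-(t * a'⁻¹ * s))‖ with hT
  have hT0 : ∀ s, 0 ≤ T s := fun s => norm_nonneg _
  set Y := Q ^ n * τ * √Q with hY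
  have hY0 : 0 ≤ Y := by positivity
  have hTY : ∑ s, T s ^ 2 ≤ Y ^ 2 := by
    refine hc.trans ?_
    rw [hQ]
    calc (Q ^ n) ^ 2 * ((N : ℝ)⁻¹ * ∑ t ∈ Bᶜ, ‖fourier f t‖ ^ 2)
        ≤ (Q ^ n) ^ 2 * ((N : ℝ)⁻¹ * (τ ^ 2 * (N * Q))) := by gcongr
      _ = (Q ^ n) ^ 2 * τ ^ 2 * Q := by field_simp
      _ = (Q ^ n) ^ 2 * τ ^ 2 * √Q ^ 2 := by rw [Real.sq_sqrt hQ0.le]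
      _ = Y ^ 2 := by rw [hY]; ring
  classical
  set w : ZMod N → ℝ := fun u => if u ∈ P then f u else 0 with hw
  have hw0 : ∀ u, 0 ≤ w u := fun u => by
    simp only [hw]; split_ifs <;> [exact hf0 u; exact le_rfl]
  have hwf : ∀ u, w u ≤ f u := fun u => by
    simp only [hw]; split_ifs <;> [exact le_rfl; exact hf0 u]
  set W := ∑ u, w u with hW
  have hWP : W = ∑ u ∈ P, f u := by simp [hW, hw, sum_ite_mem]
  have hW0 : 0 < W := by rw [hWP]; exact (mul_pos hp hQ0).trans_le hP
  have hWQ : W ≤ Q := by rw [hW, ← hQ]; exact sum_le_sum fun u _ => hwf u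
  -- Cauchy–Schwarz, with w² ≤ w because 0 ≤ w ≤ f ≤ 1.
  have hL2 : ∀ φ : ZMod N ≃ ZMod N, ∑ v, w v * T (φ v) ≤ √W * Y := by
    intro φ
    refine (Real.sum_mul_le_sqrt_mul_sqrt _ _ _).trans ?_
    gcongr
    · rw [hW]
      refine sum_le_sum fun v _ => ?_
      nlinarith [hw0 v, hwf v, hf v]
    · rw [φ.sum_comp fun s => T s ^ 2]
      exact (Real.sqrt_le_sqrt hTY).trans_eq (Real.sqrt_sq hY0)
  -- The kernel is R(σu - av), with diagonal R(ρu). Each character of σu - av splits into a function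
  -- of u times a function of v.
  have key := mul_sq_le_of_low_rank B hB (M := fun u v => R (σ * u - a * v))
    (fun u v => hR0 _) (fun t u => c t * ZMod.stdAddChar (-(t * a'⁻¹ * (σ * u))))
    (fun t v => ZMod.stdAddChar (t * a'⁻¹ * (a * v))) hw0 (δ := δ' * Q ^ n) hW.symm hW0 (by
      intro u hu
      have huP : u ∈ P := by
        by_contra h
        simp [hw, h] at hu
      rw [show σ * u - a * u = ρ * u by rw [hσρ]; ring]
      exact hδ' u huP)
  have hmain : ∀ u v, (∑ t ∈ B, c t * ZMod.stdAddChar (-(t * a'⁻¹ * (σ * u)))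
      * ZMod.stdAddChar (t * a'⁻¹ * (a * v)))
      = ∑ t ∈ B, c t * ZMod.stdAddChar (-(t * a'⁻¹ * (σ * u - a * v))) := by
    intro u v
    refine sum_congr rfl fun t _ => ?_
    rw [mul_assoc, ← AddChar.map_add_eq_mul]
    congr 2
    ring
  simp only [hmain] at key
  change δ' * Q ^ n * W ^ 2 ≤ k ^ 2 * (∑ u, ∑ v, w u * w v * (R (σ * u - a * v)
    + T (σ * u - a * v))) + k * W * ∑ u, w u * T (σ * u - a * u) at key
  have h₁ : ∑ u, ∑ v, w u * w v * (R (σ * u - a * v) + T (σ * u - a * v))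
      ≤ W * (δ * Q ^ (n + 1) + √W * Y) := by
    rw [hW, sum_mul]
    refine sum_le_sum fun u _ => ?_
    by_cases hu : u ∈ P
    · simp only [mul_assoc]
      rw [← mul_sum]
      refine mul_le_mul_of_nonneg_left ?_ (hw0 u)
      simp only [mul_add, sum_add_distrib]
      refine add_le_add ((sum_le_sum fun v _ =>
        mul_le_mul_of_nonneg_right (hwf v) (hR0 _)).trans (hδ u hu)) ?_
      exact hL2 ((Equiv.mulLeft₀ a ha).trans (Equiv.subLeft (σ * u)))
    · simp [hw, hu]
  -- As ρ ≠ 0, the diagonal u ↦ ρu is a permutation, so the L² bound controls the error there too.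
  have h₂ : ∑ u, w u * T (σ * u - a * u) ≤ √W * Y := by
    have : ∀ u, σ * u - a * u = Equiv.mulLeft₀ ρ hl u := fun u => by
      rw [Equiv.mulLeft₀_apply, hσρ]; ring
    simp only [this]
    exact hL2 _
  have hk : (1 : ℝ) ≤ k := by exact_mod_cast (Nat.zero_le _).trans_lt hB
  have hsqrt : √W * Y ≤ Q ^ (n + 1) * τ := by
    calc √W * Y ≤ √Q * Y := by gcongr
      _ = Q ^ n * τ * (√Q * √Q) := by rw [hY]; ring
      _ = Q ^ (n + 1) * τ := by rw [Real.mul_self_sqrt hQ0.le]; ring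
  have h₃ : W * (δ' * Q ^ n * W) ≤ W * (Q ^ (n + 1) * (k ^ 2 * δ + 2 * k ^ 2 * τ)) := by
    have hkk : (k : ℝ) ≤ k ^ 2 := by nlinarith
    calc W * (δ' * Q ^ n * W) = δ' * Q ^ n * W ^ 2 := by ring
      _ ≤ k ^ 2 * (W * (δ * Q ^ (n + 1) + √W * Y)) + k * W * (√W * Y) := by
        refine key.trans ?_
        gcongr
      _ ≤ k ^ 2 * (W * (δ * Q ^ (n + 1) + Q ^ (n + 1) * τ))
          + k ^ 2 * W * (Q ^ (n + 1) * τ) := by gcongr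
      _ = _ := by ring
  have h₄ := le_of_mul_le_mul_left h₃ hW0
  refine le_of_mul_le_mul_left ?_ (pow_pos hQ0 (n + 1))
  refine le_trans ?_ h₄
  calc Q ^ (n + 1) * (δ' * p) = δ' * Q ^ n * (p * Q) := by ring
    _ ≤ δ' * Q ^ n * W := by rw [hWP]; gcongr

/-- Otherwise every entry equals the sum s, so s = length · s and N divides length - 1, which lies
strictly between 0 and N. -/
theorem exists_mem_ne_sum {l : List (ZMod N)} (hl : 2 ≤ l.length) (hlN : l.length ≤ N)
    (hs : l.sum ≠ 0) : ∃ a ∈ l, l.sum - a ≠ 0 := by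
  by_contra! h
  have h₁ : l = List.replicate l.length l.sum :=
    List.eq_replicate_iff.2 ⟨rfl, fun a ha => (sub_eq_zero.1 (h a ha)).symm⟩
  have h₂ : l.sum = l.length * l.sum := by
    conv_lhs => rw [h₁]
    rw [List.sum_replicate, nsmul_eq_mul]
  have h₃ : ((l.length - 1 : ℕ) : ZMod N) = 0 := by
    rw [Nat.cast_sub (by omega), Nat.cast_one]
    refine (mul_eq_zero.1 (?_ : _ * l.sum = 0)).resolve_right hs
    rw [sub_mul, ← h₂, one_mul, sub_self]
  rw [ZMod.natCast_eq_zero_iff] at h₃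
  have := Nat.le_of_dvd (by omega) h₃
  omega

/-- For many `u` the equation `∑ i, l i * x i = (∑ i, l i) * u` has many solutions. -/
theorem le_sum_popular (hf : ∀ n, 0 ≤ f n ∧ f n ≤ 1) {θ : ℝ} (hθ : 0 < θ)
    (hQ : ∑ n, f n = θ * N) {k : ℕ} {B : Finset (ZMod N)} (hB : B.card < k) {τ r : ℝ}
    (hτ : 0 ≤ τ) (hr : 0 < r)
    (hE : ∑ t ∈ Bᶜ, ‖fourier f t‖ ^ 2 ≤ τ ^ 2 * (N * (θ * N))) {m : ℕ} (hmN : m < N)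
    (hm : ∀ n < m, k ^ 2 * (θ / 2 * r ^ (n + 1)) + 2 * k ^ 2 * τ
      < θ / 2 * r ^ n * ((2 : ℝ) ^ (n + 2))⁻¹) (n : ℕ) (hn : n ≤ m) (l : List (ZMod N))
    (hl : l.length = n + 1) (h0 : ∀ a ∈ l, a ≠ 0) (hs : l.sum ≠ 0) :
    ((2 : ℝ) ^ (n + 1))⁻¹ * (θ * N)
      ≤ ∑ u with θ / 2 * r ^ n * (θ * N) ^ n ≤ repCount f l (l.sum * u), f u := by
  have hN : (0 : ℝ) < N := Nat.cast_pos.2 (NeZero.pos N)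
  have hQ0 : 0 < θ * N := mul_pos hθ hN
  induction n generalizing l with
  | zero =>
    obtain ⟨a, rfl⟩ := List.length_eq_one_iff.1 hl
    have ha : a ≠ 0 := h0 a (by simp)
    have hR : ∀ u, repCount f [a] (a * u) = f u := by
      intro u
      simp only [repCount, ← mul_sub, mul_eq_zero, ha, false_or, sub_eq_zero, mul_ite, mul_one,
        mul_zero, sum_ite_eq, mem_univ, if_true]
    simp only [List.sum_singleton, hR, pow_zero, mul_one, zero_add, pow_one]
    -- Points with f below θ/2 carry at most half of the mass θN.
    have h₁ : ∑ u with ¬ θ / 2 ≤ f u, f u ≤ N * (θ / 2) := by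
      calc ∑ u with ¬ θ / 2 ≤ f u, f u ≤ ∑ u with ¬ θ / 2 ≤ f u, θ / 2 :=
            sum_le_sum fun u hu => (not_le.1 (mem_filter.1 hu).2).le
        _ ≤ ∑ _u : ZMod N, θ / 2 :=
            sum_le_sum_of_subset_of_nonneg (subset_univ _) fun _ _ _ => by positivity
        _ = N * (θ / 2) := by simp [ZMod.card]
    have h₂ := sum_filter_add_sum_filter_not univ (fun u => θ / 2 ≤ f u) f
    rw [hQ] at h₂
    linarith
  | succ n ih =>
    obtain ⟨a, ha, hsa⟩ := exists_mem_ne_sum (by omega) (by omega) hs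
    have hperm : l.Perm (a :: l.erase a) := List.perm_cons_erase ha
    have hlen : (l.erase a).length = n + 1 := by rw [List.length_erase_of_mem ha]; omega
    have hsum : (l.erase a).sum ≠ 0 := by
      rwa [hperm.sum_eq, List.sum_cons, add_sub_cancel_left] at hsa
    have h0' : ∀ x ∈ l.erase a, x ≠ 0 := fun x hx => h0 x (List.mem_of_mem_erase hx)
    have ih' := ih (by omega) (l.erase a) hlen h0' hsum
    rw [repCount_perm hperm, hperm.sum_eq]
    obtain ⟨a', l', hl'⟩ := List.exists_cons_of_length_eq_add_one hlen
    rw [hl'] at ih' hlen hsum h0' ⊢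
    have hlen' : l'.length = n := by simpa using hlen
    by_contra! hlt
    have hp : (0 : ℝ) < ((2 : ℝ) ^ (n + 2))⁻¹ := by positivity
    set G' := univ.filter fun u =>
      θ / 2 * r ^ n * (θ * N) ^ n ≤ repCount f (a' :: l') ((a' :: l').sum * u) with hG'
    set G := univ.filter fun u => θ / 2 * r ^ (n + 1) * (θ * N) ^ (n + 1)
      ≤ repCount f (a :: a' :: l') ((a :: a' :: l').sum * u) with hG
    -- G' has at least twice the mass 2^{-(n+2)}θN, and G is assumed to have less than that mass.
    have hP : ((2 : ℝ) ^ (n + 2))⁻¹ * (θ * N) ≤ ∑ u ∈ G' \ G, f u := by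
      have h₁ := sum_inter_add_sum_sdiff G' G f
      have h₂ : ∑ u ∈ G' ∩ G, f u ≤ ∑ u ∈ G, f u :=
        sum_le_sum_of_subset_of_nonneg inter_subset_right fun u _ _ => (hf u).1
      have h₃ : ((2 : ℝ) ^ (n + 1))⁻¹ = 2 * ((2 : ℝ) ^ (n + 2))⁻¹ := by
        rw [pow_succ _ (n + 1)]; field_simp
      rw [h₃] at ih'
      linarith
    refine (hm n (by omega)).not_ge (density_increment_le hf hQ hQ0 hB hτ hE (h0 a ha)
      (h0' a' (by simp)) hsum hp (by positivity) (G' \ G) hP ?_ ?_)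
    · intro u hu
      rw [hlen']
      exact (mem_filter.1 (mem_sdiff.1 hu).1).2
    · intro u hu
      rw [hlen']
      have := (mem_sdiff.1 hu).2
      rw [hG, mem_filter, not_and, not_le] at this
      exact (this (mem_univ u)).le

theorem le_weightedCount (hf : ∀ n, 0 ≤ f n ∧ f n ≤ 1) {θ : ℝ} (hθ : 0 < θ)
    (hQ : ∑ n, f n = θ * N) {k : ℕ} {B : Finset (ZMod N)} (hB : B.card < k) {τ r : ℝ}
    (hτ : 0 ≤ τ) (hr : 0 < r)
    (hE : ∑ t ∈ Bᶜ, ‖fourier f t‖ ^ 2 ≤ τ ^ 2 * (N * (θ * N))) {m : ℕ} (hmN : m < N)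
    (hm : ∀ n < m, k ^ 2 * (θ / 2 * r ^ (n + 1)) + 2 * k ^ 2 * τ
      < θ / 2 * r ^ n * ((2 : ℝ) ^ (n + 2))⁻¹) (a : Fin (m + 2) → ℤ)
    (h0 : ∀ i, (a i : ZMod N) ≠ 0) (hs : ∑ i, a i = 0) :
    ((2 : ℝ) ^ (m + 1))⁻¹ * (θ / 2 * r ^ m) * (θ * N) ^ (m + 1) ≤ weightedCount a f := by
  have hN : (0 : ℝ) < N := Nat.cast_pos.2 (NeZero.pos N)
  set l := List.ofFn fun i : Fin (m + 1) => (a i.succ : ZMod N) with hl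
  have hsum : l.sum = -(a 0 : ZMod N) := by
    have h := congrArg (Int.cast : ℤ → ZMod N) hs
    rw [Fin.sum_univ_succ, Int.cast_add, Int.cast_sum, Int.cast_zero] at h
    rw [hl, List.sum_ofFn]
    exact eq_neg_of_add_eq_zero_right h
  -- With u = x 0, the other variables must represent -a₀u, which is `l.sum * u`.
  have hw : weightedCount a f = ∑ u, f u * repCount f l (l.sum * u) := by
    have h := repCount_ofFn (f := f) (fun i => (a i : ZMod N)) 0
    rw [List.ofFn_succ, repCount] at h
    rw [weightedCount, ← h, hsum]
    simp only [neg_mul, zero_sub, hl]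
  have hpop := le_sum_popular hf hθ hQ hB hτ hr hE hmN hm m le_rfl l (by simp [hl])
    (by
      intro x hx
      obtain ⟨i, rfl⟩ := List.mem_ofFn.1 hx
      exact h0 _) (by rw [hsum]; exact neg_ne_zero.2 (h0 0))
  rw [hw]
  calc ((2 : ℝ) ^ (m + 1))⁻¹ * (θ / 2 * r ^ m) * (θ * N) ^ (m + 1)
      = ((2 : ℝ) ^ (m + 1))⁻¹ * (θ * N) * (θ / 2 * r ^ m * (θ * N) ^ m) := by ring
    _ ≤ (∑ u with θ / 2 * r ^ m * (θ * N) ^ m ≤ repCount f l (l.sum * u), f u)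
        * (θ / 2 * r ^ m * (θ * N) ^ m) := by gcongr
    _ ≤ ∑ u with θ / 2 * r ^ m * (θ * N) ^ m ≤ repCount f l (l.sum * u),
        f u * repCount f l (l.sum * u) := by
      rw [sum_mul]
      exact sum_le_sum fun u hu => mul_le_mul_of_nonneg_left (mem_filter.1 hu).2 (hf u).1
    _ ≤ _ := sum_le_sum_of_subset_of_nonneg (subset_univ _) fun u _ _ =>
      mul_nonneg (hf u).1 (repCount_nonneg (fun n => (hf n).1) _ _)

end Prime

/-! ### Numerical constants. -/

theorem two_pow_mul_lt_of_le {m : ℕ} (hm : 1 ≤ m) {θ y : ℝ} (hθ : 0 < θ) (hy : 1 ≤ y)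
    (h : (1000 : ℝ) ^ (m + 2) ^ 2 ≤ θ * y ^ (m + 2)) : (2 : ℝ) ^ ((m + 4) * m) < θ * y ^ (5 * m) :=
  calc (2 : ℝ) ^ ((m + 4) * m) ≤ 2 ^ (m + 2) ^ 2 :=
        pow_le_pow_right₀ one_le_two (by nlinarith)
    _ < 1000 ^ (m + 2) ^ 2 := pow_lt_pow_left₀ (by norm_num) (by norm_num) (by positivity)
    _ ≤ θ * y ^ (m + 2) := h
    _ ≤ θ * y ^ (5 * m) := by gcongr; omega

/-- Each term on the left takes at most half of the right side: the first by the choice r =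
(2^{m+4}κ²)⁻¹, the second, coming from the Fourier tail, by `h`. -/
theorem threshold_step {m : ℕ} {θ y κ : ℝ} (hθ : 0 < θ) (hκ : 1 ≤ κ) (hy : 0 < y)
    (h : (2 : ℝ) ^ ((m + 4) * m) < θ * y ^ (5 * m)) (n : ℕ) (hn : n < m) :
    κ ^ 2 * (θ / 2 * ((2 ^ (m + 4) * κ ^ 2)⁻¹) ^ (n + 1)) + 2 * κ ^ 2 * (κ ^ (2 * m) * y ^ (5 * m))⁻¹
      < θ / 2 * ((2 ^ (m + 4) * κ ^ 2)⁻¹) ^ n * ((2 : ℝ) ^ (n + 2))⁻¹ := by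
  have hκ0 : 0 < κ := one_pos.trans_le hκ
  obtain ⟨j, rfl⟩ := Nat.exists_eq_add_of_lt hn
  set A : ℝ := 2 ^ (n + j + 1 + 4) * κ ^ 2 with hA
  have hA1 : 1 ≤ A := one_le_mul_of_one_le_of_one_le (one_le_pow₀ one_le_two) (one_le_pow₀ hκ)
  have hA0 : 0 < A := one_pos.trans_le hA1
  have h₁ : κ ^ 2 * (θ / 2 * (A⁻¹) ^ (n + 1)) ≤ θ / 4 * A⁻¹ ^ n * ((2 : ℝ) ^ (n + 2))⁻¹ := by
    have e : κ ^ 2 * A⁻¹ = ((2 : ℝ) ^ (n + j + 1 + 4))⁻¹ := by rw [hA]; field_simp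
    calc κ ^ 2 * (θ / 2 * (A⁻¹) ^ (n + 1)) = θ / 2 * A⁻¹ ^ n * (κ ^ 2 * A⁻¹) := by ring
      _ = θ / 4 * A⁻¹ ^ n * (2 * ((2 : ℝ) ^ (n + j + 1 + 4))⁻¹) := by rw [e]; ring
      _ ≤ θ / 4 * A⁻¹ ^ n * ((2 : ℝ) ^ (n + 2))⁻¹ := by
        gcongr
        rw [show n + j + 1 + 4 = (n + j + 1 + 3) + 1 by ring, pow_succ (2 : ℝ) (n + j + 1 + 3),
          mul_inv, mul_comm, inv_mul_cancel_right₀ two_ne_zero]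
        gcongr
        · norm_num
        · omega
  have h₂ : 2 * κ ^ 2 * (κ ^ (2 * (n + j + 1)) * y ^ (5 * (n + j + 1)))⁻¹
      < θ / 4 * A⁻¹ ^ n * ((2 : ℝ) ^ (n + 2))⁻¹ := by
    have h₃ : 8 * κ ^ 2 * 2 ^ (n + 2) * A ^ n < θ * (κ ^ (2 * (n + j + 1)) * y ^ (5 * (n + j + 1))) := by
      calc 8 * κ ^ 2 * 2 ^ (n + 2) * A ^ n ≤ 8 * κ ^ 2 * 2 ^ (n + 2) * A ^ (n + j) := by
            gcongr; omega
        _ = κ ^ (2 * (n + j + 1)) * 2 ^ (3 + (n + 2) + (n + j + 1 + 4) * (n + j)) := by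
            rw [hA, mul_pow, pow_add 2 (3 + (n + 2)), pow_add 2 3, pow_mul 2, mul_add 2 (n + j),
              pow_add κ, pow_mul κ 2 (n + j)]
            ring
        _ ≤ κ ^ (2 * (n + j + 1)) * 2 ^ ((n + j + 1 + 4) * (n + j + 1)) := by
            gcongr
            · norm_num
            · nlinarith
        _ < κ ^ (2 * (n + j + 1)) * (θ * y ^ (5 * (n + j + 1))) := by gcongr
        _ = _ := by ring
    rw [inv_pow, ← div_eq_mul_inv, ← div_eq_mul_inv, ← div_eq_mul_inv, div_div,
      div_lt_div_iff₀ (by positivity) (by positivity)]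
    nlinarith
  have h₄ : θ / 2 * A⁻¹ ^ n * ((2 : ℝ) ^ (n + 2))⁻¹
      = θ / 4 * A⁻¹ ^ n * ((2 : ℝ) ^ (n + 2))⁻¹ + θ / 4 * A⁻¹ ^ n * ((2 : ℝ) ^ (n + 2))⁻¹ := by ring
  rw [h₄]
  exact add_lt_add_of_le_of_lt h₁ h₂

/-- The powers κ^{2m} agree on both sides; since y > 2^{m+4}, the factor y^{2m+1} outweighs the
powers of 2. -/
theorem main_constant_lt {m : ℕ} {θ y κ q : ℝ} (hθ : 0 < θ) (hκ : 1 ≤ κ) (hq : 0 < q)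
    (hy : (1000 : ℝ) ^ (m + 2) ≤ y) :
    (10 : ℝ)⁻¹ * ((4 : ℝ) ^ (m + 2))⁻¹ * (κ ^ (2 * m) * y ^ (2 * m + 1))⁻¹ * θ * q
      < ((2 : ℝ) ^ (m + 1))⁻¹ * (θ / 2 * (2 ^ (m + 4) * κ ^ 2)⁻¹ ^ m) * q := by
  have hκ0 : 0 < κ := one_pos.trans_le hκ
  have hy' : (2 : ℝ) ^ (m + 4) < y := by
    refine lt_of_lt_of_le ?_ hy
    rw [show (m + 4) = (m + 2) + 2 by ring, pow_add]
    calc (2 : ℝ) ^ (m + 2) * 2 ^ 2 ≤ 2 ^ (m + 2) * 2 ^ (m + 2) := by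
          gcongr
          · norm_num
          · omega
      _ = 4 ^ (m + 2) := by rw [← mul_pow]; norm_num
      _ < 1000 ^ (m + 2) := pow_lt_pow_left₀ (by norm_num) (by norm_num) (by positivity)
  have hy0 : 0 < y := lt_trans (by positivity) hy'
  have h₁ : (2 : ℝ) ^ (m + 2) * (2 ^ (m + 4)) ^ m < 10 * 4 ^ (m + 2) * y ^ (2 * m + 1) := by
    calc (2 : ℝ) ^ (m + 2) * (2 ^ (m + 4)) ^ m ≤ 2 ^ (m + 4) * (2 ^ (m + 4)) ^ (2 * m) := by
          gcongr
          · norm_num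
          · omega
          · exact one_le_pow₀ one_le_two
          · omega
      _ = (2 ^ (m + 4)) ^ (2 * m + 1) := by ring
      _ < y ^ (2 * m + 1) := pow_lt_pow_left₀ hy' (by positivity) (by omega)
      _ ≤ 10 * 4 ^ (m + 2) * y ^ (2 * m + 1) :=
        le_mul_of_one_le_left (by positivity)
          (one_le_mul_of_one_le_of_one_le (by norm_num) (one_le_pow₀ (by norm_num)))
  have e₁ : (10 : ℝ)⁻¹ * ((4 : ℝ) ^ (m + 2))⁻¹ * (κ ^ (2 * m) * y ^ (2 * m + 1))⁻¹ * θ * q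
      = θ * q * (κ ^ (2 * m))⁻¹ * (10 * 4 ^ (m + 2) * y ^ (2 * m + 1))⁻¹ := by
    rw [mul_inv, mul_inv, mul_inv]; ring
  have e₂ : ((2 : ℝ) ^ (m + 1))⁻¹ * (θ / 2 * (2 ^ (m + 4) * κ ^ 2)⁻¹ ^ m) * q
      = θ * q * (κ ^ (2 * m))⁻¹ * (2 ^ (m + 2) * (2 ^ (m + 4)) ^ m)⁻¹ := by
    rw [inv_pow, mul_pow, pow_mul κ, pow_succ (2 : ℝ) (m + 1), mul_inv, mul_inv, mul_inv]; ring
  rw [e₁, e₂]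
  gcongr

/-- The last two bounds come from raising to the powers ε and εd with d = m + 2; the latter turns
θ^{-1/(εd)} into θ⁻¹. -/
theorem rpow_bounds {m : ℕ} {θ ε κ : ℝ} (hθ : 0 < θ) (hθ1 : θ ≤ 1) (hε : 0 < ε)
    (h : (1000 : ℝ) ^ (((m + 2 : ℕ) : ℝ) / ε) * θ ^ (-(1 / (ε * ((m + 2 : ℕ) : ℝ)))) ≤ κ) :
    1 ≤ κ ∧ (1000 : ℝ) ^ (m + 2) ≤ κ ^ ε ∧
      (1000 : ℝ) ^ (m + 2) ^ 2 ≤ θ * (κ ^ ε) ^ (m + 2) := by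
  set D : ℝ := ((m + 2 : ℕ) : ℝ) with hD
  have hD0 : 0 < D := by rw [hD]; positivity
  have h1 : 1 ≤ θ ^ (-(1 / (ε * D))) :=
    Real.one_le_rpow_of_pos_of_le_one_of_nonpos hθ hθ1 (by rw [neg_nonpos]; positivity)
  have h2 : (1000 : ℝ) ^ (D / ε) ≤ κ :=
    (le_mul_of_one_le_right (by positivity) h1).trans h
  have hκ1 : 1 ≤ κ := (Real.one_le_rpow (by norm_num) (by positivity)).trans h2
  refine ⟨hκ1, ?_, ?_⟩
  · have := Real.rpow_le_rpow (by positivity) h2 hε.le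
    rwa [← Real.rpow_mul (by norm_num), div_mul_cancel₀ _ hε.ne', hD, Real.rpow_natCast] at this
  · have := Real.rpow_le_rpow (by positivity) h (mul_pos hε hD0).le
    rw [Real.mul_rpow (by positivity) (by positivity), ← Real.rpow_mul (by norm_num),
      ← Real.rpow_mul hθ.le, show D / ε * (ε * D) = D * D by field_simp,
      show -(1 / (ε * D)) * (ε * D) = -1 by field_simp, Real.rpow_neg_one,
      Real.rpow_mul (by norm_num), Real.rpow_mul (zero_le_one.trans hκ1), hD, Real.rpow_natCast,
      Real.rpow_natCast, Real.rpow_natCast, ← pow_mul, ← sq, ← div_eq_mul_inv,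
      div_le_iff₀ hθ] at this
    rwa [mul_comm] at this

theorem intCast_ne_zero_of_natAbs_lt {N : ℕ} {z : ℤ} (hz : z ≠ 0) (h : z.natAbs < N) :
    (z : ZMod N) ≠ 0 := by
  rw [Ne, ZMod.intCast_zmod_eq_zero_iff_dvd]
  exact fun hd => hz (Int.eq_zero_of_abs_lt_dvd hd (by rw [Int.abs_eq_natAbs]; exact_mod_cast h))

end SmoothCount

/-! ### Assembly. -/

theorem theorem1 (d : ℕ) (hd : 3 ≤ d) (a : Fin d → ℤ) (ha : ∀ i, a i ≠ 0)
    (ha_sum : ∑ i, a i = 0) (ε : ℝ) (hε : 0 < ε) (hε1 : ε < 1) :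
    ∃ N₀ : ℕ, ∀ (N : ℕ) [Fact N.Prime], N₀ ≤ N →
      ∀ (f : ZMod N → ℝ), (∀ n, 0 ≤ f n ∧ f n ≤ 1) →
      ∀ θ : ℝ, ∑ n, f n = θ * (N : ℝ) → 0 < θ * (N : ℝ) →
      ∀ b : Fin N ≃ ZMod N, SmoothCount.IsDecreasingOrder f b →
      ∀ k : ℕ,
        (1000 : ℝ) ^ ((d : ℝ) / ε) * θ ^ (-(1 / (ε * (d : ℝ)))) * Real.log (N : ℝ) ≤ (k : ℝ) →
        (k : ℝ) ≤ (N : ℝ) ^ ((1 : ℝ) / 11) →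
        SmoothCount.tailEnergy f b k
          < (k : ℝ) ^ (-((4 + 10 * ε) * ((d : ℝ) - 2))) * SmoothCount.energy f →
        (10 : ℝ)⁻¹ * ((4 : ℝ) ^ d)⁻¹
            * (k : ℝ) ^ (-2 * ((d : ℝ) - 2) - 2 * ε * ((d : ℝ) - 3 / 2))
            * θ * (θ * (N : ℝ)) ^ (d - 1)
          < SmoothCount.weightedCount a f := by
  obtain ⟨m, rfl⟩ := Nat.exists_eq_add_of_le' (show 2 ≤ d by omega)
  -- The term m + 3 gives log N ≥ 1 and m < N; the sum of |a_i| keeps each a_i nonzero modulo N.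
  refine ⟨m + 3 + ∑ i, (a i).natAbs, fun N _ hN₀ f hf θ hQ hQ0 b _ k hk _ htail => ?_⟩
  have hN : (0 : ℝ) < N := Nat.cast_pos.2 (NeZero.pos N)
  have hθ : 0 < θ := pos_of_mul_pos_left hQ0 hN.le
  have hθ1 : θ ≤ 1 := by
    refine le_of_mul_le_mul_right ?_ hN
    rw [← hQ, one_mul]
    exact (Finset.sum_le_sum fun n _ => (hf n).2).trans_eq (by simp [ZMod.card])
  have hlog : 1 ≤ Real.log N := by
    rw [Real.le_log_iff_exp_le hN]
    have : (3 : ℝ) ≤ N := by exact_mod_cast (by omega : 3 ≤ N)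
    linarith [Real.exp_one_lt_d9]
  obtain ⟨hk1, hy, hθy⟩ := SmoothCount.rpow_bounds hθ hθ1 hε
    ((le_mul_of_one_le_right (by positivity) hlog).trans hk)
  have hk0 : (0 : ℝ) < k := one_pos.trans_le hk1
  set y := (k : ℝ) ^ ε with hy_def
  have hy1 : 1 ≤ y := (one_le_pow₀ (by norm_num)).trans hy
  have hy0 : 0 < y := one_pos.trans_le hy1
  -- With d - 2 = m and y = k^ε, the tail factor is the square of τ = (k^{2m} y^{5m})⁻¹.
  have hτ : (k : ℝ) ^ (-((4 + 10 * ε) * (((m + 2 : ℕ) : ℝ) - 2)))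
      = ((k ^ (2 * m) * y ^ (5 * m))⁻¹) ^ 2 := by
    rw [Real.rpow_neg hk0.le, inv_pow, hy_def, ← Real.rpow_natCast (_ ^ ε), ← Real.rpow_mul hk0.le,
      ← Real.rpow_natCast (k : ℝ), ← Real.rpow_add hk0, ← Real.rpow_natCast (_ ^ _),
      ← Real.rpow_mul hk0.le]
    push_cast
    ring_nf
  have hexp : (k : ℝ) ^ (-2 * (((m + 2 : ℕ) : ℝ) - 2) - 2 * ε * (((m + 2 : ℕ) : ℝ) - 3 / 2))
      = (k ^ (2 * m) * y ^ (2 * m + 1))⁻¹ := by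
    rw [hy_def, ← Real.rpow_natCast (_ ^ ε), ← Real.rpow_mul hk0.le, ← Real.rpow_natCast (k : ℝ),
      ← Real.rpow_add hk0, ← Real.rpow_neg hk0.le]
    push_cast
    ring_nf
  obtain ⟨B, hB, hBt⟩ := SmoothCount.exists_sum_compl_eq_tailEnergy f b (Nat.cast_pos.1 hk0)
  have hE : ∑ t ∈ Bᶜ, ‖SmoothCount.fourier f t‖ ^ 2
      ≤ ((k ^ (2 * m) * y ^ (5 * m))⁻¹) ^ 2 * (N * (θ * N)) := by
    rw [hBt, ← hτ, ← hQ]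
    refine htail.le.trans ?_
    gcongr
    exact SmoothCount.energy_le hf
  have h0 : ∀ i, (a i : ZMod N) ≠ 0 := fun i => by
    refine SmoothCount.intCast_ne_zero_of_natAbs_lt (ha i) ?_
    have := Finset.single_le_sum (f := fun i => (a i).natAbs) (fun i _ => Nat.zero_le _)
      (Finset.mem_univ i)
    omega
  have hcount := SmoothCount.le_weightedCount hf hθ hQ hB
    (r := (2 ^ (m + 4) * (k : ℝ) ^ 2)⁻¹) (by positivity) (by positivity) hE
    (show m < N by omega)
    (SmoothCount.threshold_step hθ hk1 hy0
      (SmoothCount.two_pow_mul_lt_of_le (by omega) hθ hy1 hθy)) a h0 ha_sum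
  rw [hexp]
  exact (SmoothCount.main_constant_lt hθ hk1 (by positivity) hy).trans_le hcount
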